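/- Let $d\ge 1$ and let $\kappa:\mathbb{R}^d\times\mathbb{R}^d\to\mathbb{R}$ be a continuous, bounded, translation-invariant (positive semidefinite) kernel with reproducing kernel Hilbert space $\mathcal{H}$, normalized so that its spectral measure $\Lambda$ is a probability measure: $\kappa(\mathbf{x},\mathbf{y})=\int_{\mathbb{R}^d} e^{i\mathbf{w}^\top(\mathbf{x}-\mathbf{y})}\,d\Lambda(\mathbf{w})$. Assume that for some $S,R>0$ $$\mathbb{E}_{\mathbf{w}\sim\Lambda}\big[w_i^{2k}\big]\le \frac{k!\,S^2R^{k-2}}{2}\qquad\text{for all } i\in\{1,\dots,d\}\text{ and all integers } k\ge 2 .$$ Let $L=\big\|\mathbb{E}_{\mathbf{w}\sim\Lambda}[\mathbf{w}\mathbf{w}^\top]\big\|_2^{1/2}$ (spectral norm), which is the Lipschitz constant of $\kappa$. For a finite sequence $\mathbf{x}=(\mathbf{x}_0,\dots,\mathbf{x}_\ell)$ in $\mathbb{R}^d$ and a map $\varphi$ into a Hilbert space put $\delta\varphi(\mathbf{x}_i)=\varphi(\mathbf{x}_i)-\varphi(\mathbf{x}_{i-1})$, $1\le i\le \ell$, and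 let $\|\mathbf{x}\|_{1\text{-var}}=\sum_{i=1}^{\ell}\|\mathbf{x}_i-\mathbf{x}_{i-1}\|_2$. For an integer $m\ge1$ the level-$m$ signature kernel is $$k_m(\mathbf{x},\mathbf{y})=\langle \mathrm{S}_m(\mathbf{x}),\mathrm{S}_m(\mathbf{y})\rangle_{\mathcal{H}^{\otimes m}},\qquad \mathrm{S}_m(\mathbf{x})=\sum_{1\le i_1<\dots<i_m\le \ell}\delta\kappa_{\mathbf{x}_{i_1}}\otimes\dots\otimes\delta\kappa_{\mathbf{x}_{i_m}},\qquad \kappa_{\mathbf{x}}=\kappa(\mathbf{x},\cdot)\in\mathcal{H}.$$ For $\tilde d\ge 1$ let $\mathbf{w}^{(p)}_q$ ($1\le p\le m$, $1\le q\le\tilde d$) be i.i.d. with law $\Lambda$ and $\hat\varphi_{p,q}(\mathbf{x})=\big(\cos({\mathbf{w}^{(p)}_q}^\top\mathbf{x}),\sin({\mathbf{w}^{(p)}_q}^\top\mathbf{x})\big)\in\mathbb{R}^2$. The level-$m$ diagonally projected random Fourier signature kernel (RFSF-DP) is $$\hat k_m(\mathbf{x},\mathbf{y})=\langle \hat{\mathrm{S}}_m(\mathbf{x}),\hat{\mathrm{S}}_m(\mathbf{y})\rangle_{((\mathbb{R}^2)^{\otimes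 m})^{\tilde d}},\qquad \hat{\mathrm{S}}_m(\mathbf{x})=\frac1{\sqrt{\tilde d}}\Big(\sum_{1\le i_1<\dots<i_m\le \ell}\delta\hat\varphi_{1,q}(\mathbf{x}_{i_1})\otimes\dots\otimes\delta\hat\varphi_{m,q}(\mathbf{x}_{i_m})\Big)_{q=1}^{\tilde d}.$$ Then for all finite sequences $\mathbf{x},\mathbf{y}$ in $\mathbb{R}^d$ with positive $1$-variation and all $\epsilon>0$, $$\mathbb{P}\big[|\hat k_m(\mathbf{x},\mathbf{y})-k_m(\mathbf{x},\mathbf{y})|\ge\epsilon\big]\le 2\exp\left(-\frac14\min\left\{\left(\frac{\sqrt{\tilde d}\,\epsilon}{2C}\right)^2,\left(\frac{\tilde d\,\epsilon}{\sqrt8\,C}\right)^{1/m}\right\}\right),$$ where $$C=\sqrt8\,e^4(2\pi)^{1/4}e^{1/24}\left(\frac{4e^3\|\mathbf{x}\|_{1\text{-var}}\|\mathbf{y}\|_{1\text{-var}}}{m}\right)^m\left(\big(2d\max(S,R)\big)^m+\big(L^2/\ln2\big)^m\right)>0 .$$ If $\mathbf{x}$ or $\mathbf{y}$ has zero $1$-variation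 (so that $C=0$), the probability on the left is $0$. -/

import Mathlib

open MeasureTheory ProbabilityTheory
open scoped TensorProduct

/-- The first-order increment `v_{k+1} - v_k` of a finite sequence `(v_0, …, v_L)`. -/
def seqIncr {V : Type*} [AddCommGroup V] {L : ℕ} (v : Fin (L + 1) → V) (k : Fin L) : V :=
  v k.succ - v k.castSucc

/-- The `1`-variation `∑ ‖x_{k+1} - x_k‖₂` of a finite sequence `(x_0, …, x_L)` in `ℝ^d`. -/
noncomputable def oneVar {d L : ℕ} (x : Fin (L + 1) → EuclideanSpace ℝ (Fin d)) : ℝ :=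
  ∑ k : Fin L, ‖seqIncr x k‖

open Classical in
/-- The set of strictly increasing `m`-tuples of (increment) indices from a set of size `n`. -/
noncomputable def incrTuples (m n : ℕ) : Finset (Fin m → Fin n) :=
  Finset.univ.filter StrictMono

/-- The canonical inner product on the tensor power `V^{⊗m}` of a real inner product space, that is
the bilinear form with `⟨u_1 ⊗ ⋯ ⊗ u_m, v_1 ⊗ ⋯ ⊗ v_m⟩ = ∏ ⟨u_p, v_p⟩`.  The algebraic tensor power
suffices, since all the tensors considered are finite sums of elementary tensors. -/
noncomputable def tensorInner (V : Type*) [NormedAddCommGroup V] [InnerProductSpace ℝ V] (m : ℕ) :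
    (⨂[ℝ] _ : Fin m, V) →ₗ[ℝ] (⨂[ℝ] _ : Fin m, V) →ₗ[ℝ] ℝ :=
  (PiTensorProduct.map₂ fun _ => innerₗ V).compr₂
    (PiTensorProduct.lift (MultilinearMap.mkPiAlgebra ℝ (Fin m) ℝ))

theorem tensorInner_tprod {V : Type*} [NormedAddCommGroup V] [InnerProductSpace ℝ V] {m : ℕ}
    (u v : Fin m → V) :
    tensorInner V m (PiTensorProduct.tprod ℝ u) (PiTensorProduct.tprod ℝ v)
      = ∏ p, inner ℝ (u p) (v p) := by
  simp [tensorInner, PiTensorProduct.map₂_tprod_tprod]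

/-- The level-`m` discretized signature
`∑_{i_1 < ⋯ < i_m} δz^{(1)}_{i_1} ⊗ ⋯ ⊗ δz^{(m)}_{i_m} ∈ V^{⊗m}`,
where the `p`-th tensor factor uses the lifted sequence `z^{(p)} = (z^{(p)}_0, …, z^{(p)}_L)`. -/
noncomputable def levelSig {V : Type*} [NormedAddCommGroup V] [InnerProductSpace ℝ V] {m L : ℕ}
    (z : Fin m → Fin (L + 1) → V) : ⨂[ℝ] _ : Fin m, V :=
  ∑ i ∈ incrTuples m L, PiTensorProduct.tprod ℝ fun p => seqIncr (z p) (i p)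

/-- The level-`m` signature feature of `x`, for the canonical feature map `x ↦ κ_x = κ(x, ·)` into
the reproducing kernel Hilbert space `H` of a kernel `κ` on `ℝ^d`. -/
noncomputable def sigFeature {d : ℕ} (H : Type*) [NormedAddCommGroup H] [InnerProductSpace ℝ H]
    [RKHS ℝ H (EuclideanSpace ℝ (Fin d)) ℝ] [CompleteSpace H] (m : ℕ) {L : ℕ}
    (x : Fin (L + 1) → EuclideanSpace ℝ (Fin d)) : ⨂[ℝ] _ : Fin m, H :=
  levelSig fun _ k => RKHS.kerFun H (x k) (1 : ℝ)

/-- The level-`m` signature kernel of the kernel whose reproducing kernel Hilbert space is `H`. -/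
noncomputable def sigKernel {d : ℕ} (H : Type*) [NormedAddCommGroup H] [InnerProductSpace ℝ H]
    [RKHS ℝ H (EuclideanSpace ℝ (Fin d)) ℝ] [CompleteSpace H] (m : ℕ) {L₁ L₂ : ℕ}
    (x : Fin (L₁ + 1) → EuclideanSpace ℝ (Fin d))
    (y : Fin (L₂ + 1) → EuclideanSpace ℝ (Fin d)) : ℝ :=
  tensorInner H m (sigFeature H m x) (sigFeature H m y)

/-- The random Fourier feature map with a single frequency `w`: `x ↦ (cos wᵀx, sin wᵀx) ∈ ℝ²`. -/
noncomputable def rffMap {d : ℕ} (w x : EuclideanSpace ℝ (Fin d)) : EuclideanSpace ℝ (Fin 2) :=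
  !₂[Real.cos (inner ℝ w x), Real.sin (inner ℝ w x)]

/-- The level-`m` RFSF-DP feature with frequencies `w p q` (`p` the tensor slot, `q` the sample):
an element of `((ℝ²)^{⊗m})^n`. -/
noncomputable def dpFeature {d m n : ℕ} (w : Fin m → Fin n → EuclideanSpace ℝ (Fin d)) {L : ℕ}
    (x : Fin (L + 1) → EuclideanSpace ℝ (Fin d)) :
    Fin n → ⨂[ℝ] _ : Fin m, EuclideanSpace ℝ (Fin 2) :=
  fun q => (1 / √(n : ℝ)) • levelSig fun p k => rffMap (w p q) (x k)

/-- The level-`m` RFSF-DP kernel: the inner product of the features in `((ℝ²)^{⊗m})^n`. -/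
noncomputable def dpKernel {d m n : ℕ} (w : Fin m → Fin n → EuclideanSpace ℝ (Fin d)) {L₁ L₂ : ℕ}
    (x : Fin (L₁ + 1) → EuclideanSpace ℝ (Fin d))
    (y : Fin (L₂ + 1) → EuclideanSpace ℝ (Fin d)) : ℝ :=
  ∑ q, tensorInner (EuclideanSpace ℝ (Fin 2)) m (dpFeature w x q) (dpFeature w y q)

/-- `Λ` is the spectral measure of `κ`: `κ(x, y) = ∫ exp(i wᵀ(x - y)) dΛ(w)`. -/
def IsSpectralMeasure {d : ℕ} (Λ : Measure (EuclideanSpace ℝ (Fin d)))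
    (κ : EuclideanSpace ℝ (Fin d) → EuclideanSpace ℝ (Fin d) → ℝ) : Prop :=
  ∀ x y, (κ x y : ℂ) = ∫ w, Complex.exp (Complex.I * (inner ℝ w (x - y) : ℝ)) ∂Λ

/-- The Bernstein moment condition `E[w_i^{2k}] ≤ k! S² R^{k-2} / 2` for all `i` and `k ≥ 2`
(with finite moments). -/
def BernsteinMoments {d : ℕ} (Λ : Measure (EuclideanSpace ℝ (Fin d))) (S R : ℝ) : Prop :=
  ∀ (i : Fin d) (k : ℕ), 2 ≤ k →
    Integrable (fun w : EuclideanSpace ℝ (Fin d) => w i ^ (2 * k)) Λ ∧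
      ∫ w, w i ^ (2 * k) ∂Λ ≤ (k.factorial : ℝ) * S ^ 2 * R ^ (k - 2) / 2

/-- The second moment matrix `E[w wᵀ]` of `Λ`. -/
noncomputable def secondMoment {d : ℕ} (Λ : Measure (EuclideanSpace ℝ (Fin d))) :
    Matrix (Fin d) (Fin d) ℝ :=
  Matrix.of fun i j => ∫ w, w i * w j ∂Λ

/-- `‖E[w wᵀ]‖₂^{1/2}` (spectral norm), the Lipschitz constant of the kernel with spectral
measure `Λ`. -/
noncomputable def lipConst {d : ℕ} (Λ : Measure (EuclideanSpace ℝ (Fin d))) : ℝ :=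
  √‖Matrix.toEuclideanCLM (n := Fin d) (𝕜 := ℝ) (secondMoment Λ)‖

/-- The constant in the concentration inequality; `V₁`, `V₂` are the `1`-variations of the two
sequences and `L` is the Lipschitz constant of the kernel. -/
noncomputable def dpConst (d m : ℕ) (S R L V₁ V₂ : ℝ) : ℝ :=
  √8 * Real.exp 4 * (2 * Real.pi) ^ (1 / 4 : ℝ) * Real.exp (1 / 24)
    * (4 * Real.exp 3 * V₁ * V₂ / m) ^ m
    * ((2 * d * max S R) ^ m + (L ^ 2 / Real.log 2) ^ m)

/-! The RFSF-DP kernel is the mean of `n` independent copies of `frequencyKernel x y v`, with `v` an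
`m`-tuple of frequencies. It is unbiased because each tensor slot has its own independent frequency,
so expectations factor over slots. Cosine and sine are Lipschitz, hence `|frequencyKernel x y v| ≤ c
* ∏ p, ‖v p‖ ^ 2`, where `c` contains the `1`-variations and two factors `1 / m!`. The Bernstein
condition gives `E ‖w‖^(2l) ≤ l! (d max(S,R))^l`; a product of `m` independent such variables has
moments at most `(l!)^m A^l`, and centring replaces `A` by `2A`.

For `m ≥ 2` such moments need not yield a finite exponential moment, so Chernoff's method is
unavailable. Instead, Markov's inequality is applied to the moment of order `2k`, with `k` about the
wanted exponent. That moment is controlled by the exponential series of the moments truncated at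
degree `2k`, whose terms remain geometric when `u` is small enough (`sum_exp_weighted_le`). The two
regimes of the minimum are the two conditions on `k` in `measureReal_abs_sum_ge_le_exp_neg`. -/

/-! ### Concentration by truncated moment series -/

/-- By independence, the numbers `u^l E[T^l] / l!` of a sum `T` are the convolution of those of its
parts. Adding a variable convolves a sequence bounded by `G ^ s.card` with one of absolute sum at
most `G`; degrees up to `N` involve no higher ones, so truncation is harmless. -/
theorem integrable_pow_sum_and_moment_sum_le {Ω ι : Type*} [MeasurableSpace Ω] {P : Measure Ω}
    [IsProbabilityMeasure P] (Y : ι → Ω → ℝ)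
    (hint : ∀ q (l : ℕ), Integrable (fun ω => Y q ω ^ l) P)
    (hindep : ∀ (s : Finset ι) q, q ∉ s → IndepFun (fun ω => ∑ i ∈ s, Y i ω) (Y q) P)
    (N : ℕ) (u G : ℝ) (hu : 0 ≤ u) (hG0 : 0 ≤ G)
    (hG : ∀ q, ∑ l ∈ Finset.range (N + 1), u ^ l / l.factorial * |∫ ω, Y q ω ^ l ∂P| ≤ G)
    (s : Finset ι) :
    ∀ l : ℕ, Integrable (fun ω => (∑ i ∈ s, Y i ω) ^ l) P ∧
      (l ≤ N → u ^ l * |∫ ω, (∑ i ∈ s, Y i ω) ^ l ∂P| ≤ l.factorial * G ^ s.card) := by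
  classical
  induction s using Finset.induction_on with
  | empty =>
    intro l
    refine ⟨by simp, fun _ => ?_⟩
    rcases Nat.eq_zero_or_pos l with rfl | hl
    · simp
    · simp [zero_pow hl.ne']
  | insert q s hq ih =>
    intro l
    set T : Ω → ℝ := fun ω => ∑ i ∈ s, Y i ω with hT
    have hpow : ∀ ω, (∑ i ∈ insert q s, Y i ω) ^ l
        = ∑ i ∈ Finset.range (l + 1), (Y q ω ^ i * T ω ^ (l - i)) * (l.choose i : ℝ) := by
      intro ω
      rw [Finset.sum_insert hq, add_pow]
    have hind : ∀ a b : ℕ, IndepFun (fun ω => Y q ω ^ a) (fun ω => T ω ^ b) P := fun a b =>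
      (hindep s q hq).symm.comp (φ := fun z : ℝ => z ^ a) (ψ := fun z : ℝ => z ^ b)
        (by fun_prop) (by fun_prop)
    have hmulint : ∀ a b : ℕ, Integrable (fun ω => Y q ω ^ a * T ω ^ b) P := fun a b =>
      (hind a b).integrable_mul (hint q a) (ih b).1
    have hterm : ∀ i ∈ Finset.range (l + 1),
        Integrable (fun ω => (Y q ω ^ i * T ω ^ (l - i)) * (l.choose i : ℝ)) P :=
      fun i _ => (hmulint i (l - i)).mul_const _
    refine ⟨by simp_rw [hpow]; exact integrable_finsetSum _ hterm, fun hl => ?_⟩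
    simp_rw [hpow]
    rw [integral_finsetSum _ hterm]
    have hval : ∀ i, ∫ ω, (Y q ω ^ i * T ω ^ (l - i)) * (l.choose i : ℝ) ∂P
        = (∫ ω, Y q ω ^ i ∂P) * (∫ ω, T ω ^ (l - i) ∂P) * (l.choose i : ℝ) := by
      intro i
      rw [integral_mul_const,
        (hind i (l - i)).integral_fun_mul_eq_mul_integral (hint q i).1 (ih (l - i)).1.1]
    simp_rw [hval]
    have hGs : 0 ≤ G ^ s.card := pow_nonneg hG0 _
    calc u ^ l * |∑ i ∈ Finset.range (l + 1),
            (∫ ω, Y q ω ^ i ∂P) * (∫ ω, T ω ^ (l - i) ∂P) * (l.choose i : ℝ)|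
        ≤ u ^ l * ∑ i ∈ Finset.range (l + 1),
            |(∫ ω, Y q ω ^ i ∂P) * (∫ ω, T ω ^ (l - i) ∂P) * (l.choose i : ℝ)| := by
          gcongr
          exact Finset.abs_sum_le_sum_abs _ _
      _ ≤ ∑ i ∈ Finset.range (l + 1), l.factorial * G ^ s.card *
            (u ^ i / i.factorial * |∫ ω, Y q ω ^ i ∂P|) := by
          rw [Finset.mul_sum]
          refine Finset.sum_le_sum fun i hi => ?_
          have hil : i ≤ l := Nat.lt_succ_iff.1 (Finset.mem_range.1 hi)
          have h1 := (ih (l - i)).2 (by omega)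
          have h2 : (l.factorial : ℝ) = l.choose i * i.factorial * (l - i).factorial := by
            exact_mod_cast (Nat.choose_mul_factorial_mul_factorial hil).symm
          have h3 : u ^ l = u ^ i * u ^ (l - i) := by rw [← pow_add]; congr 1; omega
          rw [abs_mul, abs_mul, Nat.abs_cast, h2, h3]
          calc u ^ i * u ^ (l - i) * (|∫ ω, Y q ω ^ i ∂P| * |∫ ω, T ω ^ (l - i) ∂P|
                * (l.choose i : ℝ))
              = (u ^ i * |∫ ω, Y q ω ^ i ∂P| * (l.choose i : ℝ))
                * (u ^ (l - i) * |∫ ω, T ω ^ (l - i) ∂P|) := by ring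
            _ ≤ (u ^ i * |∫ ω, Y q ω ^ i ∂P| * (l.choose i : ℝ))
                * ((l - i).factorial * G ^ s.card) := by gcongr
            _ = _ := by
              have : (i.factorial : ℝ) ≠ 0 := by positivity
              field_simp
      _ = l.factorial * G ^ s.card * ∑ i ∈ Finset.range (l + 1),
            (u ^ i / i.factorial * |∫ ω, Y q ω ^ i ∂P|) := by rw [Finset.mul_sum]
      _ ≤ l.factorial * G ^ s.card * G := by
          gcongr
          refine le_trans (Finset.sum_le_sum_of_subset_of_nonneg ?_ ?_) (hG q)
          · intro i hi
            simp only [Finset.mem_range] at hi ⊢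
            omega
          · intros
            positivity
      _ = _ := by rw [Finset.card_insert_of_notMem hq, pow_succ]; ring

theorem factorial_le_two_mul_pow {N l : ℕ} (h : l + 2 ≤ N) : (l + 2).factorial ≤ 2 * N ^ l := by
  induction l with
  | zero => simp
  | succ l ih =>
    rw [show l + 1 + 2 = (l + 2) + 1 by ring, Nat.factorial_succ, pow_succ]
    calc (l + 2 + 1) * (l + 2).factorial ≤ N * (2 * N ^ l) :=
          Nat.mul_le_mul (by omega) (ih (by omega))
      _ = _ := by ring

/-- In use `a l = |E Y^l|` with `Y` centred, so the linear term disappears. For `2 ≤ l ≤ N`, the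
leftover `(l!)^(m-1)` is at most `(2 N^(l-2))^(m-1)`; after a factor `(uB)^2` is taken out, the tail
is geometric with ratio `N^(m-1) u B ≤ 1/2`. -/
theorem sum_exp_weighted_le (a : ℕ → ℝ) (m N : ℕ) (hm : 0 < m) (hN : 2 ≤ N) (u B : ℝ)
    (hu : 0 ≤ u) (hB : 0 ≤ B) (h0 : a 0 ≤ 1) (h1 : a 1 ≤ 0)
    (ha : ∀ l, a l ≤ (l.factorial : ℝ) ^ m * B ^ l)
    (huB : (N : ℝ) ^ (m - 1) * (u * B) ≤ 1 / 2) :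
    ∑ l ∈ Finset.range (N + 1), u ^ l / l.factorial * a l ≤ 1 + 2 ^ m * (u * B) ^ 2 := by
  obtain ⟨r, rfl⟩ : ∃ r, N = r + 1 := ⟨N - 1, by omega⟩
  obtain ⟨m, rfl⟩ : ∃ r, m = r + 1 := ⟨m - 1, by omega⟩
  rw [Finset.sum_range_succ', Finset.sum_range_succ']
  have hterm : ∀ l ∈ Finset.range r, u ^ (l + 1 + 1) / ((l + 1 + 1).factorial : ℝ) * a (l + 1 + 1)
      ≤ 2 ^ m * (u * B) ^ 2 * (1 / 2 : ℝ) ^ l := by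
    intro l hl
    have hl' : l + 2 ≤ r + 1 := by simp only [Finset.mem_range] at hl; omega
    have hf : ((l + 2).factorial : ℝ) ≤ 2 * ((r + 1 : ℕ) : ℝ) ^ l := by
      exact_mod_cast factorial_le_two_mul_pow hl'
    calc u ^ (l + 2) / ((l + 2).factorial : ℝ) * a (l + 2)
        ≤ u ^ (l + 2) / ((l + 2).factorial : ℝ)
          * (((l + 2).factorial : ℝ) ^ (m + 1) * B ^ (l + 2)) := by
          gcongr
          exact ha _
      _ = ((l + 2).factorial : ℝ) ^ m * (u * B) ^ (l + 2) := by
          have : ((l + 2).factorial : ℝ) ≠ 0 := by positivity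
          rw [pow_succ _ m, mul_pow]
          field_simp
      _ ≤ (2 * ((r + 1 : ℕ) : ℝ) ^ l) ^ m * (u * B) ^ (l + 2) := by gcongr
      _ = 2 ^ m * (u * B) ^ 2 * (((r + 1 : ℕ) : ℝ) ^ (m + 1 - 1) * (u * B)) ^ l := by
          rw [Nat.add_sub_cancel, mul_pow, mul_pow _ _ l, ← pow_mul, ← pow_mul, mul_comm l m]
          ring
      _ ≤ _ := by gcongr
  have hs : ∑ l ∈ Finset.range r, u ^ (l + 1 + 1) / ((l + 1 + 1).factorial : ℝ) * a (l + 1 + 1)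
      ≤ 2 ^ m * (u * B) ^ 2 * 2 := by
    refine (Finset.sum_le_sum hterm).trans ?_
    rw [← Finset.mul_sum]
    gcongr
    exact sum_geometric_two_le r
  have hu1 : u * a 1 ≤ 0 := mul_nonpos_of_nonneg_of_nonpos hu h1
  simp only [zero_add, pow_one, Nat.factorial_one, Nat.cast_one, div_one, pow_zero,
    Nat.factorial_zero, one_mul]
  rw [pow_succ 2 m]
  linarith

theorem measureReal_abs_sum_ge_le_exp_neg {Ω : Type*} [MeasurableSpace Ω] {P : Measure Ω}
    [IsProbabilityMeasure P] {n : ℕ} (Y : Fin n → Ω → ℝ)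
    (hint : ∀ q (l : ℕ), Integrable (fun ω => Y q ω ^ l) P)
    (hindep : ∀ (s : Finset (Fin n)) q, q ∉ s → IndepFun (fun ω => ∑ i ∈ s, Y i ω) (Y q) P)
    (hmean : ∀ q, ∫ ω, Y q ω ∂P = 0) {m : ℕ} (hm : 0 < m) {B : ℝ} (hB : 0 ≤ B)
    (hmom : ∀ q (l : ℕ), |∫ ω, Y q ω ^ l ∂P| ≤ (l.factorial : ℝ) ^ m * B ^ l)
    {k : ℕ} (hk : 0 < k) {t : ℝ} (ht : 0 < t)
    (h1 : 2 * Real.exp 1 * (2 * k) ^ m * B ≤ t)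
    (h2 : n * 2 ^ m * (4 * k * Real.exp 1 ^ 2) * B ^ 2 ≤ t ^ 2) :
    P.real {ω | t ≤ |∑ q, Y q ω|} ≤ Real.exp (-k) := by
  set e := Real.exp 1 with he
  have hepos : 0 < e := Real.exp_pos 1
  have hkR : (0 : ℝ) < k := by exact_mod_cast hk
  -- Chosen so that `u t = 2ke`: Markov then costs `(2k)! / (2ke)^(2k) ≤ e^(-2k)`, which absorbs
  -- `G^n ≤ e^k`. Hypothesis `h1` makes the series geometric, and `h2` bounds `G^n`.
  set u : ℝ := 2 * k * e / t with hu
  have hupos : 0 < u := by positivity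
  set G : ℝ := 1 + 2 ^ m * (u * B) ^ 2 with hG
  have hG0 : 0 ≤ G := by positivity
  have huB : ((2 * k : ℕ) : ℝ) ^ (m - 1) * (u * B) ≤ 1 / 2 := by
    obtain ⟨r, rfl⟩ : ∃ r, m = r + 1 := ⟨m - 1, by omega⟩
    simp only [Nat.add_sub_cancel]
    push_cast
    rw [hu]
    rw [pow_succ] at h1
    have : (2 * (k : ℝ)) ^ r * (2 * k * e / t * B) = (2 * e * ((2 * k) ^ r * (2 * k)) * B) / t / 2 := by
      field_simp
    rw [this]
    have := (div_le_one ht).2 h1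
    linarith
  have hmoment := (integrable_pow_sum_and_moment_sum_le Y hint hindep (2 * k) u G hupos.le hG0
    (fun q => sum_exp_weighted_le _ m (2 * k) hm (by omega) u B hupos.le hB (by simp)
      (by simp [hmean]) (hmom q) huB) Finset.univ (2 * k))
  obtain ⟨hi, hmo⟩ := hmoment
  replace hmo := hmo le_rfl
  rw [Finset.card_univ, Fintype.card_fin] at hmo
  have hGn : G ^ n ≤ Real.exp k := by
    calc G ^ n ≤ Real.exp (2 ^ m * (u * B) ^ 2) ^ n := by
          gcongr
          rw [hG, add_comm]
          exact Real.add_one_le_exp _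
      _ = Real.exp (n * (2 ^ m * (u * B) ^ 2)) := by rw [← Real.exp_nat_mul]
      _ ≤ Real.exp k := by
          gcongr
          have : (n : ℝ) * (2 ^ m * (u * B) ^ 2)
              = (n * 2 ^ m * (4 * k * e ^ 2) * B ^ 2) / t ^ 2 * k := by
            rw [hu]; field_simp; ring
          rw [this]
          have := (div_le_one (by positivity)).2 h2
          nlinarith
  have hmarkov : t ^ (2 * k) * P.real {ω | t ≤ |∑ q, Y q ω|} ≤ ∫ ω, (∑ q, Y q ω) ^ (2 * k) ∂P := by
    refine le_trans ?_ (mul_meas_ge_le_integral_of_nonneg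
      (Filter.Eventually.of_forall fun ω => (even_two_mul k).pow_nonneg _) hi (t ^ (2 * k)))
    refine mul_le_mul_of_nonneg_left (measureReal_mono fun ω hω => ?_) (by positivity)
    simp only [Set.mem_ofPred_eq] at hω ⊢
    rw [← (even_two_mul k).pow_abs (∑ i, Y i ω)]
    exact pow_le_pow_left₀ ht.le hω _
  have hfac : ((2 * k).factorial : ℝ) ≤ (2 * k : ℝ) ^ (2 * k) := by
    exact_mod_cast Nat.factorial_le_pow (2 * k)
  have hkey : (2 * k * e) ^ (2 * k) * P.real {ω | t ≤ |∑ q, Y q ω|}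
      ≤ (2 * k : ℝ) ^ (2 * k) * Real.exp k := by
    calc (2 * k * e) ^ (2 * k) * P.real {ω | t ≤ |∑ q, Y q ω|}
        = u ^ (2 * k) * (t ^ (2 * k) * P.real {ω | t ≤ |∑ q, Y q ω|}) := by
          rw [← mul_assoc, ← mul_pow, hu, div_mul_cancel₀ _ ht.ne']
      _ ≤ u ^ (2 * k) * |∫ ω, (∑ q, Y q ω) ^ (2 * k) ∂P| := by
          gcongr
          exact hmarkov.trans (le_abs_self _)
      _ ≤ (2 * k).factorial * G ^ n := hmo
      _ ≤ _ := by gcongr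
  rw [mul_pow, mul_assoc] at hkey
  have hkey2 := le_of_mul_le_mul_left hkey (by positivity)
  have hek : e ^ (2 * k) = Real.exp k * Real.exp k := by
    rw [he, ← Real.exp_nat_mul, ← Real.exp_add]
    congr 1
    push_cast
    ring
  rw [hek, mul_assoc] at hkey2
  have hp := Real.exp_pos (k : ℝ)
  rw [Real.exp_neg, ← one_div, le_div_iff₀ hp]
  nlinarith

/-- Concentration of the mean of independent centred variables with `|E Yˡ| ≤ (l!)ᵐ Bˡ`. -/
theorem measureReal_abs_mean_ge_le {Ω : Type*} [MeasurableSpace Ω] {P : Measure Ω}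
    [IsProbabilityMeasure P] {n : ℕ} (hn : 0 < n) (Y : Fin n → Ω → ℝ)
    (hint : ∀ q (l : ℕ), Integrable (fun ω => Y q ω ^ l) P)
    (hindep : ∀ (s : Finset (Fin n)) q, q ∉ s → IndepFun (fun ω => ∑ i ∈ s, Y i ω) (Y q) P)
    (hmean : ∀ q, ∫ ω, Y q ω ∂P = 0) {m : ℕ} (hm : 0 < m) {B C : ℝ} (hB : 0 ≤ B) (hC : 0 < C)
    (hBC : 6 * 2 ^ m * B ≤ C)
    (hmom : ∀ q (l : ℕ), |∫ ω, Y q ω ^ l ∂P| ≤ (l.factorial : ℝ) ^ m * B ^ l)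
    {ε : ℝ} (hε : 0 < ε) :
    P.real {ω | ε ≤ |(∑ q, Y q ω) / n|} ≤ 2 * Real.exp (-(1 / 4) *
      min ((√(n : ℝ) * ε / (2 * C)) ^ 2) ((n * ε / (√8 * C)) ^ (1 / (m : ℝ)))) := by
  have hnR : (0 : ℝ) < n := by exact_mod_cast hn
  have hmR : (m : ℝ) ≠ 0 := by exact_mod_cast hm.ne'
  set b := (n * ε / (√8 * C)) ^ (1 / (m : ℝ)) with hb
  set s : ℝ := 1 / 4 * min ((√(n : ℝ) * ε / (2 * C)) ^ 2) b with hs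
  have hs1 : 4 * s ≤ (√(n : ℝ) * ε / (2 * C)) ^ 2 := by
    rw [hs]; linarith [min_le_left ((√(n : ℝ) * ε / (2 * C)) ^ 2) b]
  have hs2 : 4 * s ≤ b := by
    rw [hs]; linarith [min_le_right ((√(n : ℝ) * ε / (2 * C)) ^ 2) b]
  have hneg : -(1 / 4) * min ((√(n : ℝ) * ε / (2 * C)) ^ 2) b = -s := by rw [hs]; ring
  rw [hneg]
  have hs0 : 0 ≤ s := by rw [hs]; positivity
  -- For `s ≤ 1/2` the bound is trivial, as `2 exp(-s) ≥ 2(1 - s) ≥ 1`. Otherwise rounding up is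
  -- cheap: `⌈s⌉ < s + 1 < 3s`.
  rcases le_or_gt s (1 / 2) with hsm | hsm
  · refine measureReal_le_one.trans ?_
    have := Real.add_one_le_exp (-s)
    linarith
  have hset : {ω | ε ≤ |(∑ q, Y q ω) / n|} = {ω | n * ε ≤ |∑ q, Y q ω|} := by
    ext ω
    simp only [Set.mem_ofPred_eq]
    rw [abs_div, Nat.abs_cast, le_div_iff₀ hnR, mul_comm]
  rw [hset]
  have hk1 : (⌈s⌉₊ : ℝ) ≤ 3 * s := by
    have := Nat.ceil_lt_add_one hs0
    linarith
  have he3 : Real.exp 1 ≤ 3 := Real.exp_one_lt_three.le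
  have ht2 : 16 * n * s * C ^ 2 ≤ (n * ε) ^ 2 := by
    rw [div_pow, le_div_iff₀ (by positivity), mul_pow, mul_pow _ ε, Real.sq_sqrt hnR.le] at hs1
    nlinarith
  have hsqrt : 2 ≤ √(8 : ℝ) := Real.le_sqrt_of_sq_le (by norm_num)
  have ht1 : 2 * C * (4 * s) ^ m ≤ n * ε := by
    have h1 : (4 * s) ^ m ≤ b ^ m := by gcongr
    rw [hb, ← Real.rpow_natCast (_ ^ (1 / (m : ℝ))), ← Real.rpow_mul (by positivity),
      one_div_mul_cancel hmR, Real.rpow_one, le_div_iff₀ (by positivity)] at h1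
    refine le_trans ?_ h1
    have : 0 ≤ (4 * s) ^ m * C := by positivity
    nlinarith
  have hpm : (1 : ℝ) ≤ 2 ^ m := one_le_pow₀ (by norm_num)
  refine (measureReal_abs_sum_ge_le_exp_neg Y hint hindep hmean hm hB hmom
    (k := ⌈s⌉₊) (Nat.ceil_pos.2 (by linarith)) (t := n * ε) (by positivity) ?_ ?_).trans ?_
  · refine le_trans ?_ ht1
    -- Since `2⌈s⌉ ≤ 6s ≤ 2 * (4s)`, rounding costs the factor `2^m` present in `hBC`; the `6` there
    -- is `2e` rounded up.
    calc 2 * Real.exp 1 * (2 * (⌈s⌉₊ : ℝ)) ^ m * B ≤ 2 * 3 * (2 * (4 * s)) ^ m * B := by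
          gcongr
          linarith
      _ = (6 * 2 ^ m * B) * (4 * s) ^ m := by rw [mul_pow]; ring
      _ ≤ C * (4 * s) ^ m := by gcongr
      _ ≤ 2 * C * (4 * s) ^ m := by
          have : 0 ≤ C * (4 * s) ^ m := by positivity
          linarith
  · refine le_trans ?_ ht2
    calc n * 2 ^ m * (4 * (⌈s⌉₊ : ℝ) * Real.exp 1 ^ 2) * B ^ 2
        ≤ n * 2 ^ m * (4 * (3 * s) * 3 ^ 2) * B ^ 2 := by gcongr
      _ = 3 * n * s * (2 ^ m * (6 ^ 2 * B ^ 2)) := by ring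
      _ ≤ 16 * n * s * (2 ^ m * 2 ^ m * (6 ^ 2 * B ^ 2)) := by
          gcongr
          · norm_num
          · exact le_mul_of_one_le_left (by positivity) hpm
      _ = 16 * n * s * (6 * 2 ^ m * B) ^ 2 := by ring
      _ ≤ 16 * n * s * C ^ 2 := by gcongr
  · have h1 : Real.exp (-(⌈s⌉₊ : ℝ)) ≤ Real.exp (-s) := by
      gcongr
      exact Nat.le_ceil s
    linarith [Real.exp_pos (-s)]

/-! ### The kernel of one frequency tuple -/

/-- The `m!` rearrangements of the increasing tuples are distinct, and each gives a term of the
expansion of `(∑ k, a k) ^ m`. Distinctness holds because an increasing tuple is determined by its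
range, and its injectivity then recovers the permutation. -/
theorem sum_incrTuples_prod_le {m n : ℕ} (a : Fin n → ℝ) (ha : ∀ i, 0 ≤ a i) :
    ∑ i ∈ incrTuples m n, ∏ p, a (i p) ≤ (∑ k, a k) ^ m / m.factorial := by
  classical
  rw [le_div_iff₀ (by positivity)]
  have hinj : Set.InjOn (fun c : (Fin m → Fin n) × Equiv.Perm (Fin m) => c.1 ∘ c.2)
      (incrTuples m n ×ˢ (Finset.univ : Finset (Equiv.Perm (Fin m))) : Finset _) := by
    rintro ⟨i, σ⟩ hi ⟨j, τ⟩ hj hij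
    simp only [incrTuples, Finset.coe_product, Finset.coe_filter, Set.mem_prod, Set.mem_ofPred_eq,
      Finset.mem_univ, true_and] at hi hj hij
    have hr : Set.range i = Set.range j := by
      rw [← σ.surjective.range_comp i, ← τ.surjective.range_comp j, hij]
    obtain rfl := (hi.1.range_inj hj.1).1 hr
    simp only [Prod.mk.injEq, true_and]
    ext p : 1
    exact hi.1.injective (congrFun hij p)
  calc (∑ i ∈ incrTuples m n, ∏ p, a (i p)) * m.factorial
      = ∑ c ∈ incrTuples m n ×ˢ (Finset.univ : Finset (Equiv.Perm (Fin m))),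
          ∏ p, a ((c.1 ∘ c.2) p) := by
        rw [Finset.sum_product, Finset.sum_mul]
        refine Finset.sum_congr rfl fun i _ => ?_
        simp only [Function.comp_apply]
        rw [Finset.sum_congr rfl fun σ _ => Equiv.prod_comp σ fun p => a (i p)]
        simp [Fintype.card_perm, mul_comm]
    _ = ∑ f ∈ (incrTuples m n ×ˢ (Finset.univ : Finset (Equiv.Perm (Fin m)))).image
          (fun c => c.1 ∘ c.2), ∏ p, a (f p) := 
        (Finset.sum_image (f := fun f => ∏ p, a (f p)) hinj).symm
    _ ≤ ∑ f : Fin m → Fin n, ∏ p, a (f p) :=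
        Finset.sum_le_sum_of_subset_of_nonneg (Finset.subset_univ _)
          fun _ _ _ => Finset.prod_nonneg fun _ _ => ha _
    _ = (∑ k, a k) ^ m := by
        simpa using (Finset.prod_univ_sum (fun _ : Fin m => Finset.univ) fun _ k => a k).symm

theorem tensorInner_levelSig {V : Type*} [NormedAddCommGroup V] [InnerProductSpace ℝ V]
    {m L₁ L₂ : ℕ} (z : Fin m → Fin (L₁ + 1) → V) (z' : Fin m → Fin (L₂ + 1) → V) :
    tensorInner V m (levelSig z) (levelSig z')
      = ∑ i ∈ incrTuples m L₁, ∑ j ∈ incrTuples m L₂,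
          ∏ p, inner ℝ (seqIncr (z p) (i p)) (seqIncr (z' p) (j p)) := by
  simp only [levelSig, map_sum, LinearMap.sum_apply, tensorInner_tprod]
  rw [Finset.sum_comm]

/-- The contribution of one tuple of frequencies to the RFSF-DP kernel. -/
noncomputable def frequencyKernel {d m L₁ L₂ : ℕ} (x : Fin (L₁ + 1) → EuclideanSpace ℝ (Fin d))
    (y : Fin (L₂ + 1) → EuclideanSpace ℝ (Fin d)) (v : Fin m → EuclideanSpace ℝ (Fin d)) : ℝ :=
  ∑ i ∈ incrTuples m L₁, ∑ j ∈ incrTuples m L₂,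
    ∏ p, inner ℝ (seqIncr (fun k => rffMap (v p) (x k)) (i p))
      (seqIncr (fun k => rffMap (v p) (y k)) (j p))

theorem dpKernel_eq_mean {d m n : ℕ} (w : Fin m → Fin n → EuclideanSpace ℝ (Fin d)) {L₁ L₂ : ℕ}
    (x : Fin (L₁ + 1) → EuclideanSpace ℝ (Fin d))
    (y : Fin (L₂ + 1) → EuclideanSpace ℝ (Fin d)) :
    dpKernel w x y = (∑ q, frequencyKernel x y fun p => w p q) / n := by
  simp only [dpKernel, dpFeature, map_smul, LinearMap.smul_apply, tensorInner_levelSig, smul_eq_mul,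
    frequencyKernel]
  rw [Finset.sum_div]
  refine Finset.sum_congr rfl fun q _ => ?_
  rw [← mul_assoc, div_mul_div_comm, Real.mul_self_sqrt n.cast_nonneg]
  ring

theorem inner_rffMap {d : ℕ} (w a b : EuclideanSpace ℝ (Fin d)) :
    inner ℝ (rffMap w a) (rffMap w b) = Real.cos (inner ℝ w (a - b)) := by
  rw [inner_sub_right, Real.cos_sub]
  simp [rffMap, PiLp.inner_apply, Fin.sum_univ_two, mul_comm]

/-- With `θ = ⟨w, a - b⟩`, the squared distance is `2 - 2 cos θ ≤ θ^2`. -/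
theorem norm_rffMap_sub_le {d : ℕ} (w a b : EuclideanSpace ℝ (Fin d)) :
    ‖rffMap w a - rffMap w b‖ ≤ ‖w‖ * ‖a - b‖ := by
  refine le_trans ?_ (abs_real_inner_le_norm w (a - b))
  rw [← sq_le_sq₀ (norm_nonneg _) (abs_nonneg _), sq_abs, norm_sub_sq_real,
    ← real_inner_self_eq_norm_sq, ← real_inner_self_eq_norm_sq]
  simp only [inner_rffMap, sub_self, inner_zero_right, Real.cos_zero]
  linarith [Real.one_sub_sq_div_two_le_cos (x := inner ℝ w (a - b))]

theorem abs_frequencyKernel_le {d m L₁ L₂ : ℕ} (x : Fin (L₁ + 1) → EuclideanSpace ℝ (Fin d))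
    (y : Fin (L₂ + 1) → EuclideanSpace ℝ (Fin d)) (v : Fin m → EuclideanSpace ℝ (Fin d)) :
    |frequencyKernel x y v| ≤
      (oneVar x ^ m / m.factorial) * (oneVar y ^ m / m.factorial) * ∏ p, ‖v p‖ ^ 2 := by
  have hinner : ∀ (u : EuclideanSpace ℝ (Fin d)) (i : Fin L₁) (j : Fin L₂),
      |inner ℝ (seqIncr (fun k => rffMap u (x k)) i) (seqIncr (fun k => rffMap u (y k)) j)|
        ≤ ‖seqIncr x i‖ * ‖seqIncr y j‖ * ‖u‖ ^ 2 := by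
    intro u i j
    refine (abs_real_inner_le_norm _ _).trans ?_
    calc _ ≤ (‖u‖ * ‖seqIncr x i‖) * (‖u‖ * ‖seqIncr y j‖) := by
          gcongr <;> exact norm_rffMap_sub_le _ _ _
      _ = _ := by ring
  calc |frequencyKernel x y v|
      ≤ ∑ i ∈ incrTuples m L₁, ∑ j ∈ incrTuples m L₂,
          ((∏ p, ‖seqIncr x (i p)‖) * (∏ p, ‖seqIncr y (j p)‖)) * ∏ p, ‖v p‖ ^ 2 := by
        refine (Finset.abs_sum_le_sum_abs _ _).trans (Finset.sum_le_sum fun i _ => ?_)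
        refine (Finset.abs_sum_le_sum_abs _ _).trans (Finset.sum_le_sum fun j _ => ?_)
        rw [Finset.abs_prod, ← Finset.prod_mul_distrib, ← Finset.prod_mul_distrib]
        exact Finset.prod_le_prod (fun _ _ => abs_nonneg _) fun p _ => hinner _ _ _
    _ = (∑ i ∈ incrTuples m L₁, ∏ p, ‖seqIncr x (i p)‖)
          * (∑ j ∈ incrTuples m L₂, ∏ p, ‖seqIncr y (j p)‖) * ∏ p, ‖v p‖ ^ 2 := by
        rw [Finset.sum_mul_sum, Finset.sum_mul]
        simp_rw [Finset.sum_mul]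
    _ ≤ _ := by
        have hx := sum_incrTuples_prod_le (m := m) (fun k => ‖seqIncr x k‖) fun _ => norm_nonneg _
        have hy := sum_incrTuples_prod_le (m := m) (fun k => ‖seqIncr y k‖) fun _ => norm_nonneg _
        have hx0 : 0 ≤ ∑ i ∈ incrTuples m L₁, ∏ p, ‖seqIncr x (i p)‖ := by positivity
        have hy0 : 0 ≤ ∑ j ∈ incrTuples m L₂, ∏ p, ‖seqIncr y (j p)‖ := by positivity
        exact mul_le_mul_of_nonneg_right (mul_le_mul hx hy hy0 (hx0.trans hx)) (by positivity)

theorem continuous_rffMap_left {d : ℕ} (a : EuclideanSpace ℝ (Fin d)) :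
    Continuous fun w => rffMap w a := by
  unfold rffMap
  refine (PiLp.continuous_toLp 2 _).comp (continuous_pi fun i => ?_)
  fin_cases i <;> simp <;> fun_prop

theorem continuous_frequencyKernel {d m L₁ L₂ : ℕ} (x : Fin (L₁ + 1) → EuclideanSpace ℝ (Fin d))
    (y : Fin (L₂ + 1) → EuclideanSpace ℝ (Fin d)) :
    Continuous (frequencyKernel (m := m) x y) := by
  unfold frequencyKernel seqIncr
  have h : ∀ (p : Fin m) (a : EuclideanSpace ℝ (Fin d)),
      Continuous fun v : Fin m → EuclideanSpace ℝ (Fin d) => rffMap (v p) a :=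
    fun p a => (continuous_rffMap_left a).comp (continuous_apply p)
  refine continuous_finsetSum _ fun i _ => continuous_finsetSum _ fun j _ =>
    continuous_finsetProd _ fun p _ => ?_
  exact ((h _ _).sub (h _ _)).inner ((h _ _).sub (h _ _))

/-! ### Unbiasedness -/

section Spectral

variable {d : ℕ} {κ : EuclideanSpace ℝ (Fin d) → EuclideanSpace ℝ (Fin d) → ℝ}
  {Λ : Measure (EuclideanSpace ℝ (Fin d))} [IsProbabilityMeasure Λ]

theorem integrable_inner_rffMap (a b : EuclideanSpace ℝ (Fin d)) :
    Integrable (fun w => inner ℝ (rffMap w a) (rffMap w b)) Λ := by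
  simp_rw [inner_rffMap]
  refine Integrable.of_bound (Continuous.aestronglyMeasurable (by fun_prop)) 1
    (Filter.Eventually.of_forall fun w => ?_)
  exact Real.abs_cos_le_one _

theorem IsSpectralMeasure.integral_inner_rffMap (hΛ : IsSpectralMeasure Λ κ)
    (a b : EuclideanSpace ℝ (Fin d)) :
    ∫ w, inner ℝ (rffMap w a) (rffMap w b) ∂Λ = κ a b := by
  have hint : Integrable
      (fun w : EuclideanSpace ℝ (Fin d) => Complex.exp (Complex.I * (inner ℝ w (a - b) : ℝ))) Λ := by
    refine Integrable.of_bound (Continuous.aestronglyMeasurable (by fun_prop)) 1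
      (Filter.Eventually.of_forall fun w => ?_)
    rw [mul_comm, Complex.norm_exp_ofReal_mul_I]
  have h := congrArg Complex.re (hΛ a b)
  rw [Complex.ofReal_re] at h
  rw [h]
  have h2 := integral_re hint
  simp only [RCLike.re_eq_complex_re] at h2
  rw [← h2]
  refine integral_congr_ae (Filter.Eventually.of_forall fun w => ?_)
  simp only [inner_rffMap]
  rw [mul_comm, Complex.exp_ofReal_mul_I_re]

theorem IsSpectralMeasure.integral_inner_seqIncr_rffMap (hΛ : IsSpectralMeasure Λ κ)
    {H : Type*} [NormedAddCommGroup H] [InnerProductSpace ℝ H] [CompleteSpace H]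
    [RKHS ℝ H (EuclideanSpace ℝ (Fin d)) ℝ]
    (hH : ∀ x y, RKHS.kernel H x y (1 : ℝ) = κ x y)
    {L₁ L₂ : ℕ} (x : Fin (L₁ + 1) → EuclideanSpace ℝ (Fin d))
    (y : Fin (L₂ + 1) → EuclideanSpace ℝ (Fin d)) (i : Fin L₁) (j : Fin L₂) :
    Integrable (fun w => inner ℝ (seqIncr (fun k => rffMap w (x k)) i)
        (seqIncr (fun k => rffMap w (y k)) j)) Λ ∧
      ∫ w, inner ℝ (seqIncr (fun k => rffMap w (x k)) i)
        (seqIncr (fun k => rffMap w (y k)) j) ∂Λ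
      = inner ℝ (seqIncr (fun k => RKHS.kerFun H (x k) (1 : ℝ)) i)
          (seqIncr (fun k => RKHS.kerFun H (y k) (1 : ℝ)) j) := by
  have hker : ∀ a b : EuclideanSpace ℝ (Fin d),
      inner ℝ (RKHS.kerFun H a (1 : ℝ)) (RKHS.kerFun H b (1 : ℝ)) = κ a b := by
    intro a b
    rw [RKHS.kerFun_inner, RKHS.kerFun_apply, hH]
    simp
  have hi : ∀ a b : EuclideanSpace ℝ (Fin d),
      Integrable (fun w => inner ℝ (rffMap w a) (rffMap w b)) Λ := integrable_inner_rffMap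
  have hi2 : ∀ a b a' b' : EuclideanSpace ℝ (Fin d), Integrable (fun w =>
      inner ℝ (rffMap w a) (rffMap w b) - inner ℝ (rffMap w a') (rffMap w b')) Λ :=
    fun _ _ _ _ => (hi _ _).sub (hi _ _)
  simp only [seqIncr, inner_sub_left, inner_sub_right, hker]
  refine ⟨(hi2 _ _ _ _).sub (hi2 _ _ _ _), ?_⟩
  rw [integral_sub (hi2 _ _ _ _) (hi2 _ _ _ _), integral_sub (hi _ _) (hi _ _),
    integral_sub (hi _ _) (hi _ _)]
  simp only [hΛ.integral_inner_rffMap]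

/-- The product law turns the integral of each product over slots into a product of integrals, and
each of these is an inner product of increments in `H` by the spectral formula and the reproducing
property. -/
theorem IsSpectralMeasure.integral_frequencyKernel (hΛ : IsSpectralMeasure Λ κ)
    {H : Type*} [NormedAddCommGroup H] [InnerProductSpace ℝ H] [CompleteSpace H]
    [RKHS ℝ H (EuclideanSpace ℝ (Fin d)) ℝ]
    (hH : ∀ x y, RKHS.kernel H x y (1 : ℝ) = κ x y) (m : ℕ)
    {L₁ L₂ : ℕ} (x : Fin (L₁ + 1) → EuclideanSpace ℝ (Fin d))
    (y : Fin (L₂ + 1) → EuclideanSpace ℝ (Fin d)) :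
    ∫ v, frequencyKernel x y v ∂(Measure.pi fun _ : Fin m => Λ) = sigKernel H m x y := by
  have hint : ∀ (i : Fin m → Fin L₁) (j : Fin m → Fin L₂), Integrable
      (fun v : Fin m → EuclideanSpace ℝ (Fin d) =>
        ∏ p, inner ℝ (seqIncr (fun k => rffMap (v p) (x k)) (i p))
          (seqIncr (fun k => rffMap (v p) (y k)) (j p))) (Measure.pi fun _ : Fin m => Λ) :=
    fun i j => Integrable.fintype_prod_dep
      (f := fun p u => inner ℝ (seqIncr (fun k => rffMap u (x k)) (i p))
        (seqIncr (fun k => rffMap u (y k)) (j p)))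
      fun p => (hΛ.integral_inner_seqIncr_rffMap hH x y (i p) (j p)).1
  unfold frequencyKernel sigKernel sigFeature
  rw [tensorInner_levelSig, integral_finsetSum _ fun i _ => integrable_finsetSum _ fun j _ =>
    hint i j]
  refine Finset.sum_congr rfl fun i _ => ?_
  rw [integral_finsetSum _ fun j _ => hint i j]
  refine Finset.sum_congr rfl fun j _ => ?_
  rw [integral_fintype_prod_eq_prod (fun p u => inner ℝ (seqIncr (fun k => rffMap u (x k)) (i p))
        (seqIncr (fun k => rffMap u (y k)) (j p)))]
  exact Finset.prod_congr rfl fun p _ =>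
    (hΛ.integral_inner_seqIncr_rffMap hH x y (i p) (j p)).2

end Spectral

/-! ### Sequences of zero variation -/

theorem seqIncr_eq_zero_of_oneVar_eq_zero {d L : ℕ} {x : Fin (L + 1) → EuclideanSpace ℝ (Fin d)}
    (h : oneVar x = 0) {V : Type*} [AddCommGroup V] (f : EuclideanSpace ℝ (Fin d) → V)
    (k : Fin L) : seqIncr (fun k => f (x k)) k = 0 := by
  have h1 := (Finset.sum_eq_zero_iff_of_nonneg fun _ _ => norm_nonneg _).1 h k (Finset.mem_univ k)
  rw [norm_eq_zero, seqIncr, sub_eq_zero] at h1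
  rw [seqIncr, h1, sub_self]

theorem levelSig_eq_zero_of_oneVar_eq_zero {d L m : ℕ} (hm : 0 < m)
    {x : Fin (L + 1) → EuclideanSpace ℝ (Fin d)} (h : oneVar x = 0) {V : Type*}
    [NormedAddCommGroup V] [InnerProductSpace ℝ V] (f : Fin m → EuclideanSpace ℝ (Fin d) → V) :
    levelSig (fun p k => f p (x k)) = 0 :=
  Finset.sum_eq_zero fun _ _ => MultilinearMap.map_coord_zero _ (⟨0, hm⟩ : Fin m)
    (seqIncr_eq_zero_of_oneVar_eq_zero h _ _)

theorem dpKernel_eq_sigKernel_of_oneVar_eq_zero {d : ℕ} {H : Type*} [NormedAddCommGroup H]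
    [InnerProductSpace ℝ H] [CompleteSpace H] [RKHS ℝ H (EuclideanSpace ℝ (Fin d)) ℝ]
    {m n : ℕ} (hm : 0 < m) (w : Fin m → Fin n → EuclideanSpace ℝ (Fin d)) {L₁ L₂ : ℕ}
    {x : Fin (L₁ + 1) → EuclideanSpace ℝ (Fin d)} {y : Fin (L₂ + 1) → EuclideanSpace ℝ (Fin d)}
    (h : oneVar x = 0 ∨ oneVar y = 0) : dpKernel w x y = sigKernel H m x y := by
  rcases h with h | h
  · simp [dpKernel, dpFeature, sigKernel, sigFeature,
      levelSig_eq_zero_of_oneVar_eq_zero hm h fun p => rffMap (w p _),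
      levelSig_eq_zero_of_oneVar_eq_zero hm h fun _ a => RKHS.kerFun H a (1 : ℝ)]
  · simp [dpKernel, dpFeature, sigKernel, sigFeature,
      levelSig_eq_zero_of_oneVar_eq_zero hm h fun p => rffMap (w p _),
      levelSig_eq_zero_of_oneVar_eq_zero hm h fun _ a => RKHS.kerFun H a (1 : ℝ)]

/-! ### Moment bounds -/

theorem BernsteinMoments.integral_norm_pow_le {d : ℕ} (hd : 0 < d)
    {Λ : Measure (EuclideanSpace ℝ (Fin d))} [IsProbabilityMeasure Λ] {S R : ℝ} (hS : 0 < S)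
    (hR : 0 < R) (hSR : BernsteinMoments Λ S R) (k : ℕ) :
    Integrable (fun w : EuclideanSpace ℝ (Fin d) => (‖w‖ ^ 2) ^ k) Λ ∧
      ∫ w, (‖w‖ ^ 2) ^ k ∂Λ ≤ k.factorial * (d * max S R) ^ k := by
  have hdR : (0 : ℝ) < d := by exact_mod_cast hd
  have key : ∀ j : ℕ, Integrable (fun w : EuclideanSpace ℝ (Fin d) => (‖w‖ ^ 2) ^ (j + 2)) Λ ∧
      ∫ w, (‖w‖ ^ 2) ^ (j + 2) ∂Λ
        ≤ (d : ℝ) ^ (j + 2) * ((j + 2).factorial * S ^ 2 * R ^ j / 2) := by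
    intro j
    have hpt : ∀ w : EuclideanSpace ℝ (Fin d),
        (‖w‖ ^ 2) ^ (j + 2) ≤ (d : ℝ) ^ (j + 1) * ∑ i, w i ^ (2 * (j + 2)) := by
      intro w
      -- Power-mean inequality for the `d` squared coordinates.
      have h := pow_sum_div_card_le_sum_pow (s := Finset.univ) (f := fun i => w i ^ 2)
        (fun i _ => sq_nonneg _) (j + 1)
      rw [Finset.card_univ, Fintype.card_fin, div_le_iff₀ (by positivity)] at h
      rw [EuclideanSpace.real_norm_sq_eq, mul_comm]
      simpa only [pow_mul] using h
    have hint : Integrable (fun w : EuclideanSpace ℝ (Fin d) =>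
        (d : ℝ) ^ (j + 1) * ∑ i, w i ^ (2 * (j + 2))) Λ :=
      (integrable_finsetSum _ fun i _ => (hSR i (j + 2) (by omega)).1).const_mul _
    have hi : Integrable (fun w : EuclideanSpace ℝ (Fin d) => (‖w‖ ^ 2) ^ (j + 2)) Λ := by
      refine hint.mono' (Continuous.aestronglyMeasurable (by fun_prop))
        (Filter.Eventually.of_forall fun w => ?_)
      rw [Real.norm_of_nonneg (by positivity)]
      exact hpt w
    refine ⟨hi, (integral_mono hi hint hpt).trans ?_⟩
    rw [integral_const_mul, integral_finsetSum _ fun i _ => (hSR i (j + 2) (by omega)).1]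
    calc (d : ℝ) ^ (j + 1) * ∑ i, ∫ w, w i ^ (2 * (j + 2)) ∂Λ
        ≤ (d : ℝ) ^ (j + 1) * ∑ _i : Fin d, ((j + 2).factorial * S ^ 2 * R ^ j / 2 : ℝ) := by
          gcongr with i
          simpa using (hSR i (j + 2) (by omega)).2
      _ = _ := by simp; ring
  match k with
  | 0 => simp
  | 1 =>
    obtain ⟨hi, hle⟩ := key 0
    have hc : 0 < d * S := by positivity
    -- The Bernstein condition starts at `k = 2`, so the second moment comes from the fourth by
    -- AM-GM; the weight `d * S` fits `E ‖w‖^4 ≤ (d * S)^2`.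
    have hpt : ∀ w : EuclideanSpace ℝ (Fin d),
        (‖w‖ ^ 2) ^ 1 ≤ (d * S + (‖w‖ ^ 2) ^ (0 + 2) / (d * S)) / 2 := by
      intro w
      have : (d * S + (‖w‖ ^ 2) ^ (0 + 2) / (d * S)) / 2 - (‖w‖ ^ 2) ^ 1
          = (d * S - ‖w‖ ^ 2) ^ 2 / (2 * (d * S)) := by
        field_simp
        ring
      have h2 : 0 ≤ (d * S - ‖w‖ ^ 2) ^ 2 / (2 * (d * S)) := by positivity
      linarith
    have hint : Integrable (fun w : EuclideanSpace ℝ (Fin d) =>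
        (d * S + (‖w‖ ^ 2) ^ (0 + 2) / (d * S)) / 2) Λ :=
      ((integrable_const _).add (hi.div_const _)).div_const _
    have hi1 : Integrable (fun w : EuclideanSpace ℝ (Fin d) => (‖w‖ ^ 2) ^ 1) Λ := by
      refine hint.mono' (Continuous.aestronglyMeasurable (by fun_prop))
        (Filter.Eventually.of_forall fun w => ?_)
      rw [Real.norm_of_nonneg (by positivity)]
      exact hpt w
    refine ⟨hi1, (integral_mono hi1 hint hpt).trans ?_⟩
    rw [integral_div, integral_add (integrable_const _) (hi.div_const _), integral_div]
    have h3 : (∫ w, (‖w‖ ^ 2) ^ (0 + 2) ∂Λ) / (d * S) ≤ d * S := by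
      rw [div_le_iff₀ hc]
      refine hle.trans (le_of_eq ?_)
      norm_num [Nat.factorial]
      ring
    have h4 : d * S ≤ d * max S R := by gcongr; exact le_max_left _ _
    simp
    linarith
  | j + 2 =>
    refine ⟨(key j).1, (key j).2.trans ?_⟩
    have h1 : S ^ 2 * R ^ j ≤ max S R ^ 2 * max S R ^ j := by
      gcongr
      · exact le_max_left _ _
      · exact le_max_right _ _
    calc (d : ℝ) ^ (j + 2) * ((j + 2).factorial * S ^ 2 * R ^ j / 2)
        = (d : ℝ) ^ (j + 2) * (j + 2).factorial * (S ^ 2 * R ^ j) / 2 := by ring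
      _ ≤ (d : ℝ) ^ (j + 2) * (j + 2).factorial * (max S R ^ 2 * max S R ^ j) := by
          refine (half_le_self (by positivity)).trans ?_
          gcongr
      _ = _ := by rw [mul_pow]; ring

/-- The case `l = 1` bounds the mean by `A`; convexity, `(D + A)^l ≤ 2^(l-1) (D^l + A^l)`, then
turns `A` into `2A`. -/
theorem centered_moments_le {α : Type*} [MeasurableSpace α] {ν : Measure α}
    [IsProbabilityMeasure ν] {Z D : α → ℝ} (hZ : AEStronglyMeasurable Z ν) (hZD : ∀ v, |Z v| ≤ D v)
    {m : ℕ} {A : ℝ} (hA : 0 ≤ A) (hint : ∀ l : ℕ, Integrable (fun v => D v ^ l) ν)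
    (hmom : ∀ l : ℕ, ∫ v, D v ^ l ∂ν ≤ (l.factorial : ℝ) ^ m * A ^ l) :
    (∀ l : ℕ, Integrable (fun v => (Z v - ∫ v, Z v ∂ν) ^ l) ν) ∧
      (∫ v, (Z v - ∫ v, Z v ∂ν) ∂ν = 0) ∧
      ∀ l : ℕ, |∫ v, (Z v - ∫ v, Z v ∂ν) ^ l ∂ν| ≤ (l.factorial : ℝ) ^ m * (2 * A) ^ l := by
  have hD0 : ∀ v, 0 ≤ D v := fun v => (abs_nonneg _).trans (hZD v)
  have hDi : Integrable D ν := by simpa using hint 1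
  have hZi : Integrable Z ν := hDi.mono' hZ (Filter.Eventually.of_forall hZD)
  set μ := ∫ v, Z v ∂ν with hμ
  have hμA : |μ| ≤ A := by
    calc |μ| ≤ ∫ v, |Z v| ∂ν := abs_integral_le_integral_abs
      _ ≤ ∫ v, D v ∂ν := integral_mono hZi.abs hDi hZD
      _ ≤ A := by simpa using hmom 1
  have hpt : ∀ (l : ℕ) v, |(Z v - μ) ^ l| ≤ 2 ^ (l - 1) * (D v ^ l + A ^ l) := by
    intro l v
    rw [abs_pow]
    calc |Z v - μ| ^ l ≤ (D v + A) ^ l := by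
          gcongr
          exact (abs_sub _ _).trans (add_le_add (hZD v) hμA)
      _ ≤ _ := add_pow_le (hD0 v) hA l
  have hbi : ∀ l : ℕ, Integrable (fun v => 2 ^ (l - 1) * (D v ^ l + A ^ l)) ν := fun l =>
    ((hint l).add (integrable_const _)).const_mul _
  have hi : ∀ l : ℕ, Integrable (fun v => (Z v - μ) ^ l) ν := fun l =>
    (hbi l).mono' ((hZ.sub aestronglyMeasurable_const).pow l)
      (Filter.Eventually.of_forall (hpt l))
  refine ⟨hi, ?_, fun l => ?_⟩
  · rw [integral_sub hZi (integrable_const _)]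
    simp [hμ]
  -- At `l = 0` truncated subtraction makes the convexity bound equal to `2`, too weak for the
  -- required `1`.
  · rcases l with _ | l
    · simp
    calc |∫ v, (Z v - μ) ^ (l + 1) ∂ν| ≤ ∫ v, |(Z v - μ) ^ (l + 1)| ∂ν :=
          abs_integral_le_integral_abs
      _ ≤ ∫ v, 2 ^ l * (D v ^ (l + 1) + A ^ (l + 1)) ∂ν :=
          integral_mono (hi _).abs (hbi (l + 1)) (hpt (l + 1))
      _ = 2 ^ l * ((∫ v, D v ^ (l + 1) ∂ν) + A ^ (l + 1)) := by
          rw [integral_const_mul, integral_add (hint _) (integrable_const _)]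
          simp
      _ ≤ 2 ^ l * (((l + 1).factorial : ℝ) ^ m * A ^ (l + 1)
            + ((l + 1).factorial : ℝ) ^ m * A ^ (l + 1)) := by
          gcongr
          · exact hmom _
          · refine le_mul_of_one_le_left (by positivity) (one_le_pow₀ ?_)
            exact_mod_cast Nat.one_le_iff_ne_zero.2 (Nat.factorial_ne_zero _)
      _ = _ := by rw [mul_pow]; ring

/-- Independent slots contribute one `l!` each: this is the source of `(l!)^m`, hence of the
exponent `1/m` in the tail. -/
theorem integral_prod_norm_pow_le {d : ℕ} (hd : 0 < d)
    {Λ : Measure (EuclideanSpace ℝ (Fin d))} [IsProbabilityMeasure Λ] {S R : ℝ} (hS : 0 < S)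
    (hR : 0 < R) (hSR : BernsteinMoments Λ S R) {m : ℕ} {c : ℝ} (hc : 0 ≤ c) (l : ℕ) :
    Integrable (fun v : Fin m → EuclideanSpace ℝ (Fin d) => (c * ∏ p, ‖v p‖ ^ 2) ^ l)
        (Measure.pi fun _ : Fin m => Λ) ∧
      ∫ v, (c * ∏ p, ‖v p‖ ^ 2) ^ l ∂(Measure.pi fun _ : Fin m => Λ)
        ≤ (l.factorial : ℝ) ^ m * (c * (d * max S R) ^ m) ^ l := by
  simp_rw [mul_pow c, ← Finset.prod_pow]
  have h := hSR.integral_norm_pow_le hd hS hR l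
  refine ⟨(Integrable.fintype_prod (f := fun _ w => (‖w‖ ^ 2) ^ l) fun _ => h.1).const_mul _, ?_⟩
  rw [integral_const_mul, integral_fintype_prod_eq_prod (fun _ w => (‖w‖ ^ 2) ^ l)]
  rw [Finset.prod_const, Finset.card_univ, Fintype.card_fin]
  calc c ^ l * (∫ w, (‖w‖ ^ 2) ^ l ∂Λ) ^ m
      ≤ c ^ l * (l.factorial * (d * max S R) ^ l) ^ m := by
        have : 0 ≤ ∫ w, (‖w‖ ^ 2) ^ l ∂Λ := integral_nonneg fun w => by positivity
        gcongr
        exact h.2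
    _ = _ := by rw [mul_pow _ _ m, ← pow_mul, ← pow_mul, mul_comm l m]; ring

/-! ### Independence of samples, the constant, and conclusion -/

theorem indepFun_sum_comp_block {Ω E ι κ : Type*} [Fintype ι] [MeasurableSpace Ω]
    [MeasurableSpace E] {P : Measure Ω} {w : ι → κ → Ω → E}
    (hw : ∀ p q, AEMeasurable (w p q) P)
    (hindep : iIndepFun (fun pq : ι × κ => w pq.1 pq.2) P) {F : (ι → E) → ℝ} (hF : Measurable F)
    {s : Finset κ} {q : κ} (hq : q ∉ s) :
    IndepFun (fun ω => ∑ i ∈ s, F fun p => w p i ω) (fun ω => F fun p => w p q ω) P := by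
  classical
  have hdisj : Disjoint ((Finset.univ : Finset ι) ×ˢ s) ((Finset.univ : Finset ι) ×ˢ {q}) :=
    Finset.disjoint_product.2 (Or.inr (Finset.disjoint_singleton_right.2 hq))
  have h := hindep.indepFun_finset₀ _ _ hdisj fun pq => hw pq.1 pq.2
  have h2 := h.comp
    (φ := fun f => ∑ i ∈ s.attach, F fun p => f ⟨(p, i.1), by simp⟩)
    (ψ := fun f => F fun p => f ⟨(p, q), by simp⟩)
    (Finset.measurable_fun_sum _ fun i _ =>
      hF.comp (measurable_pi_lambda _ fun p => measurable_pi_apply _))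
    (hF.comp (measurable_pi_lambda _ fun p => measurable_pi_apply _))
  convert h2 using 1
  · ext ω
    simp only [Function.comp_apply]
    rw [Finset.sum_attach s fun i => F fun p => w p i ω]
  · rfl

theorem dpConst_pos_and_moment_const_le {d m : ℕ} (hd : 0 < d) (hm : 0 < m) {S R L V₁ V₂ : ℝ}
    (hS : 0 < S) (hV₁ : 0 < V₁) (hV₂ : 0 < V₂) :
    0 < dpConst d m S R L V₁ V₂ ∧
      6 * 2 ^ m * (2 * ((V₁ ^ m / m.factorial) * (V₂ ^ m / m.factorial) * (d * max S R) ^ m))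
        ≤ dpConst d m S R L V₁ V₂ := by
  have hdR : (0 : ℝ) < d := by exact_mod_cast hd
  have hmR : (0 : ℝ) < m := by exact_mod_cast hm
  set M := max S R with hM
  have hM0 : 0 < M := hS.trans_le (le_max_left _ _)
  have hlog : 0 < Real.log 2 := Real.log_pos (by norm_num)
  have hL : 0 ≤ (L ^ 2 / Real.log 2) ^ m := by positivity
  refine ⟨by unfold dpConst; positivity, ?_⟩
  have h8 : 2 ≤ √(8 : ℝ) := Real.le_sqrt_of_sq_le (by norm_num)
  have he1 : 2 ≤ Real.exp 1 := by linarith [Real.add_one_le_exp (1 : ℝ)]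
  have he4 : 16 ≤ Real.exp 4 := by
    rw [show (4 : ℝ) = (4 : ℕ) * 1 by norm_num, Real.exp_nat_mul]
    calc (16 : ℝ) = 2 ^ 4 := by norm_num
      _ ≤ _ := by gcongr
  have hpi : 1 ≤ (2 * Real.pi) ^ (1 / 4 : ℝ) :=
    Real.one_le_rpow (by linarith [Real.pi_gt_three]) (by norm_num)
  have he24 : 1 ≤ Real.exp (1 / 24) := Real.one_le_exp (by norm_num)
  have hconst : 32 ≤ √8 * Real.exp 4 * (2 * Real.pi) ^ (1 / 4 : ℝ) * Real.exp (1 / 24) := by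
    calc (32 : ℝ) = 2 * 16 * 1 * 1 := by norm_num
      _ ≤ _ := by gcongr
  -- One of the two factors `1 / m!` supplies the `m^(-m)` of the constant; the other is only
  -- bounded by `1`.
  have hfac : 1 / (m.factorial : ℝ) ≤ (Real.exp 1 / m) ^ m := by
    have h := Real.pow_div_factorial_le_exp (m : ℝ) hmR.le m
    have h2 : Real.exp (m : ℝ) = Real.exp 1 ^ m := by rw [← Real.exp_nat_mul, mul_one]
    rw [h2] at h
    rw [div_pow, le_div_iff₀ (by positivity)]
    calc 1 / (m.factorial : ℝ) * (m : ℝ) ^ m = (m : ℝ) ^ m / m.factorial := by ring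
      _ ≤ _ := h
  have hfac1 : 1 / (m.factorial : ℝ) ≤ 1 := by
    rw [div_le_one (by positivity)]
    exact_mod_cast Nat.one_le_iff_ne_zero.2 (Nat.factorial_ne_zero _)
  have hexp3 : Real.exp 1 ≤ Real.exp 3 := by gcongr; norm_num
  calc 6 * 2 ^ m * (2 * ((V₁ ^ m / m.factorial) * (V₂ ^ m / m.factorial) * (d * M) ^ m))
      = 12 * 2 ^ m * (1 / (m.factorial : ℝ)) * (1 / (m.factorial : ℝ))
          * (V₁ * V₂ * (d * M)) ^ m := by rw [mul_pow, mul_pow]; ring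
    _ ≤ 12 * 2 ^ m * 1 * (Real.exp 1 / m) ^ m * (V₁ * V₂ * (d * M)) ^ m := by gcongr
    -- The `8^m` splits into the `4^m` and the `2^m` of `dpConst`; its nonnegative Lipschitz summand
    -- is added at the end.
    _ ≤ 32 * 8 ^ m * 1 * (Real.exp 3 / m) ^ m * (V₁ * V₂ * (d * M)) ^ m := by
        gcongr <;> norm_num
    _ = 32 * (4 * Real.exp 3 * V₁ * V₂ / m) ^ m * ((2 * d * M) ^ m) := by
        rw [mul_one, mul_assoc 32, mul_assoc 32, ← mul_pow, mul_assoc 32, ← mul_pow, ← mul_pow]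
        congr 2
        ring
    _ ≤ dpConst d m S R L V₁ V₂ := by
        unfold dpConst
        gcongr
        exact le_add_of_nonneg_right hL

theorem mainTheorem2 {d : ℕ} (hd : 0 < d)
    (κ : EuclideanSpace ℝ (Fin d) → EuclideanSpace ℝ (Fin d) → ℝ)
    (hκ_cont : Continuous (Function.uncurry κ))
    (hκ_bdd : ∃ B : ℝ, ∀ x y, |κ x y| ≤ B)
    (hκ_inv : ∀ x y z, κ (x + z) (y + z) = κ x y)
    -- `H` is the reproducing kernel Hilbert space of `κ`
    {H : Type*} [NormedAddCommGroup H] [InnerProductSpace ℝ H] [CompleteSpace H]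
    [RKHS ℝ H (EuclideanSpace ℝ (Fin d)) ℝ]
    (hH : ∀ x y, RKHS.kernel H x y (1 : ℝ) = κ x y)
    (Λ : Measure (EuclideanSpace ℝ (Fin d))) [IsProbabilityMeasure Λ]
    (hΛ : IsSpectralMeasure Λ κ)
    (S R : ℝ) (hS : 0 < S) (hR : 0 < R) (hSR : BernsteinMoments Λ S R)
    (m n : ℕ) (hm : 0 < m) (hn : 0 < n)
    -- the random frequencies are independent with law `Λ`
    {Ω : Type*} [MeasurableSpace Ω] (P : Measure Ω) [IsProbabilityMeasure P]
    (w : Fin m → Fin n → Ω → EuclideanSpace ℝ (Fin d))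
    (hw_law : ∀ p q, HasLaw (w p q) Λ P)
    (hw_indep : iIndepFun (fun pq : Fin m × Fin n => w pq.1 pq.2) P)
    {L₁ L₂ : ℕ} (x : Fin (L₁ + 1) → EuclideanSpace ℝ (Fin d))
    (y : Fin (L₂ + 1) → EuclideanSpace ℝ (Fin d)) (ε : ℝ) (hε : 0 < ε) :
    (0 < oneVar x → 0 < oneVar y →
      0 < dpConst d m S R (lipConst Λ) (oneVar x) (oneVar y) ∧
      P.real {ω | ε ≤ |dpKernel (fun p q => w p q ω) x y - sigKernel H m x y|} ≤
        2 * Real.exp (-(1 / 4) * min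
          ((√(n : ℝ) * ε / (2 * dpConst d m S R (lipConst Λ) (oneVar x) (oneVar y))) ^ 2)
          (((n : ℝ) * ε / (√8 * dpConst d m S R (lipConst Λ) (oneVar x) (oneVar y)))
            ^ (1 / (m : ℝ))))) ∧
    -- the degenerate case, in which the constant vanishes
    (oneVar x = 0 ∨ oneVar y = 0 →
      P.real {ω | ε ≤ |dpKernel (fun p q => w p q ω) x y - sigKernel H m x y|} = 0) := by
  refine ⟨fun hx hy => ?_, fun h => ?_⟩
  · obtain ⟨hC, hAC⟩ := dpConst_pos_and_moment_const_le (m := m) (R := R) (L := lipConst Λ) hd hm hS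
      hx hy
    refine ⟨hC, ?_⟩
    set c := (oneVar x ^ m / m.factorial) * (oneVar y ^ m / m.factorial) with hc
    have hc0 : 0 ≤ c := by positivity
    have hM0 : 0 ≤ max S R := hS.le.trans (le_max_left _ _)
    have hcont := continuous_frequencyKernel (m := m) x y
    obtain ⟨hint, hmean, hmom⟩ := centered_moments_le (m := m)
      (ν := Measure.pi fun _ : Fin m => Λ) hcont.aestronglyMeasurable
      (abs_frequencyKernel_le x y) (A := c * (d * max S R) ^ m) (by positivity)
      (fun l => (integral_prod_norm_pow_le hd hS hR hSR hc0 l).1)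
      (fun l => (integral_prod_norm_pow_le hd hS hR hSR hc0 l).2)
    rw [hΛ.integral_frequencyKernel hH] at hint hmean hmom
    set μ := sigKernel H m x y with hμ
    -- For fixed `q`, the frequencies in the `m` slots are a subfamily of an independent family, so
    -- their joint law is the product.
    have hlaw : ∀ q, HasLaw (fun ω p => w p q ω) (Measure.pi fun _ : Fin m => Λ) P := fun q =>
      iIndepFun.hasLaw_pi (fun p => hw_law p q)
        (hw_indep.precomp (g := fun p : Fin m => (p, q)) fun _ _ h => (Prod.mk.inj h).1)
    have hF : Continuous fun v => frequencyKernel (m := m) x y v - μ := hcont.sub continuous_const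
    have hval : ∀ q (l : ℕ), ∫ ω, (frequencyKernel x y (fun p => w p q ω) - μ) ^ l ∂P
        = ∫ v, (frequencyKernel x y v - μ) ^ l ∂(Measure.pi fun _ : Fin m => Λ) := fun q l =>
      (hlaw q).integral_comp (hF.pow l).aestronglyMeasurable
    have hconc := measureReal_abs_mean_ge_le hn
      (fun q ω => frequencyKernel x y (fun p => w p q ω) - μ)
      (fun q l => by
        have h := hint l
        rw [← (hlaw q).map_eq] at h
        exact h.comp_aemeasurable (hlaw q).aemeasurable)
      (fun s q hq => indepFun_sum_comp_block (fun p q => (hw_law p q).aemeasurable) hw_indep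
        hF.measurable hq)
      (fun q => by simpa using (hval q 1).trans (by simpa using hmean)) hm
      (B := 2 * (c * (d * max S R) ^ m)) (by positivity) hC hAC
      (fun q l => by rw [hval]; exact hmom l) hε
    have hset : ∀ ω, dpKernel (fun p q => w p q ω) x y - μ
        = (∑ q, (frequencyKernel x y (fun p => w p q ω) - μ)) / n := by
      intro ω
      have hnR : (n : ℝ) ≠ 0 := by exact_mod_cast hn.ne'
      rw [dpKernel_eq_mean, Finset.sum_sub_distrib, sub_div]
      simp [hnR]
    simpa only [hset] using hconc
  · have hempty : {ω | ε ≤ |dpKernel (fun p q => w p q ω) x y - sigKernel H m x y|} = ∅ := by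
      ext ω
      simp [dpKernel_eq_sigKernel_of_oneVar_eq_zero (H := H) hm (fun p q => w p q ω) h, hε]
    rw [hempty, measureReal_empty]
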